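/- Let $X\subset\mathbb R^2$ be a smooth ($C^\infty$) simple closed convex curve whose curvature $\kappa$ vanishes nowhere (no flat points), and assume that $X$ is not a circle. An orthotricentre of $X$ is a point $Q$ that lies on the normals to $X$ at three distinct points of $X$; let $\mathcal T$ be the set of all orthotricentres. The caustic (evolute) $C(X)$ is the set of centres of curvature of $X$, and its domains are the connected components of $\mathbb R^2\setminus C(X)$. For $Q\in\mathbb R^2$ let $n(Q)$ be the number of points $P\in X$ such that $Q$ lies on the normal to $X$ at $P$. The interior region of the caustic is the closure of the union of the bounded domains, and the core of the caustic is the closure of the union of those domains all of whose points satisfy $n(Q)\ge 4$. (If there are only finitely many domains, these are the union of the compact closed domains and the union of the closed domains whose interior points have at least four emanating normals.) Then the closure $\overline{\mathcal T}$ is a compact subset of the interior region of the caustic, and it coincides with the core of the caustic. Moreover, $\overline{\mathcal T}$ is obtained from $\mathcal T$ by adding only the centres of curvature at the vertices of $X$ (the limits of orthotripods whose three points merge): $$\overline{\mathcal T}=\mathcal T\cup\{\text{centres of curvature at the points of } X \text{ where } \kappa'=0\}.$$ -/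

import Mathlib

open scoped ContDiff

noncomputable section

namespace ConvexCaustic

/-- The Euclidean plane. -/
abbrev Plane := EuclideanSpace ℝ (Fin 2)

/-- The tangent vector (of unit length when `γ` is parametrized by arclength). -/
def tangent (γ : ℝ → Plane) (s : ℝ) : Plane := deriv γ s

/-- The normal vector, obtained from the tangent vector by a rotation through `π / 2`, so that
`(tangent γ s, normal γ s)` is positively oriented. -/
def normal (γ : ℝ → Plane) (s : ℝ) : Plane := !₂[-(tangent γ s 1), tangent γ s 0]

/-- The signed curvature of a curve parametrized by arclength: `T' = κ N`. -/
def curvature (γ : ℝ → Plane) (s : ℝ) : ℝ := inner ℝ (deriv (tangent γ) s) (normal γ s)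

/-- `γ` is an arclength parametrization, with period `L`, of a smooth simple closed convex curve
in the plane. Convexity: the curve lies on one side of each of its tangent lines. -/
structure IsClosedConvexCurve (γ : ℝ → Plane) (L : ℝ) : Prop where
  length_pos : 0 < L
  smooth : ContDiff ℝ ∞ γ
  unit_speed : ∀ s, ‖tangent γ s‖ = 1
  periodic : Function.Periodic γ L
  simple : Set.InjOn γ (Set.Ico 0 L)
  convex : ∀ s, (∀ t, 0 ≤ inner ℝ (γ t - γ s) (normal γ s)) ∨
    (∀ t, inner ℝ (γ t - γ s) (normal γ s) ≤ 0)

/-- The centre of curvature at the parameter `s`. -/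
def curvatureCentre (γ : ℝ → Plane) (s : ℝ) : Plane := γ s + (curvature γ s)⁻¹ • normal γ s

/-- The caustic (evolute): the set of all centres of curvature. -/
def caustic (γ : ℝ → Plane) : Set Plane := Set.range (curvatureCentre γ)

/-- The points `P` of the curve such that `Q` lies on the normal line to the curve at `P`. -/
def feet (γ : ℝ → Plane) (Q : Plane) : Set Plane :=
  {P | ∃ s, γ s = P ∧ inner ℝ (Q - P) (tangent γ s) = 0}

/-- The number of normals to the curve emanating from `Q` (counted by their feet). -/
def numNormals (γ : ℝ → Plane) (Q : Plane) : ℕ∞ := (feet γ Q).encard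

/-- The set `T` of three (distinct) points of the curve is an orthotripod with orthotricentre `Q`:
the normals at the three points all pass through `Q`. -/
def IsOrthotripodWithCentre (γ : ℝ → Plane) (T : Finset Plane) (Q : Plane) : Prop :=
  T.card = 3 ∧ ∀ P ∈ T, P ∈ feet γ Q

/-- The set of all orthotricentres. -/
def orthotricentres (γ : ℝ → Plane) : Set Plane :=
  {Q | ∃ T : Finset Plane, IsOrthotripodWithCentre γ T Q}

/-- The centres of curvature at the vertices, that is, at the critical points of the curvature. -/
def vertexCentres (γ : ℝ → Plane) : Set Plane :=
  {Q | ∃ s, deriv (curvature γ) s = 0 ∧ Q = curvatureCentre γ s}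

/-- The (open) domains into which the caustic divides the plane: the connected components of its
complement. -/
def domains (γ : ℝ → Plane) : Set (Set Plane) :=
  {U | ∃ Q ∈ (caustic γ)ᶜ, U = connectedComponentIn (caustic γ)ᶜ Q}

/-- The bounded domains. -/
def boundedDomains (γ : ℝ → Plane) : Set (Set Plane) :=
  {U ∈ domains γ | Bornology.IsBounded U}

/-- The domains whose points have at least four emanating normals. -/
def coreDomains (γ : ℝ → Plane) : Set (Set Plane) :=
  {U ∈ domains γ | ∀ Q ∈ U, 4 ≤ numNormals γ Q}

/-- The interior region of the caustic: the bounded domains together with their limit points.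
When there are finitely many domains this is the union of the compact closed domains, see
`interiorRegion_eq`. -/
def interiorRegion (γ : ℝ → Plane) : Set Plane := closure (⋃ U ∈ boundedDomains γ, U)

/-- The core of the caustic: the domains whose points have at least four emanating normals,
together with their limit points. When there are finitely many domains this is the union of the
corresponding closed domains, see `core_eq`. -/
def core (γ : ℝ → Plane) : Set Plane := closure (⋃ U ∈ coreDomains γ, U)

theorem interiorRegion_eq (γ : ℝ → Plane) (h : (domains γ).Finite) :
    interiorRegion γ = ⋃ U ∈ boundedDomains γ, closure U :=
  (h.subset fun _ hU => hU.1).closure_biUnion _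

theorem core_eq (γ : ℝ → Plane) (h : (domains γ).Finite) :
    core γ = ⋃ U ∈ coreDomains γ, closure U :=
  (h.subset fun _ hU => hU.1).closure_biUnion _

end ConvexCaustic

end

open Filter Topology

noncomputable section

namespace ConvexCaustic

/-! ### Periodic functions and their zeros -/

/-! The feet of the normals from `Q` are the zeros over one period of `g s = pedal γ (1, Q) s`, the
derivative of minus half the squared distance to `Q`; centres of curvature correspond to double
zeros, and centres at vertices to triple zeros. As the derivative of a periodic function, `g` cannot
keep a weak sign unless it vanishes identically, which happens only when the curve is a circle.

The orthotricentres are compared with an open set, the points `Q` for which `g` alternates in sign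
at four cyclically ordered parameters. Such a `Q` has four feet. Conversely, off the caustic all
zeros are simple, and three simple zeros force four alternations by parity
(`alternates_of_simple_zeros`). Every point of the caustic is a limit of alternating points
(`caustic_subset_closure`), so both sets have the same closure.

In a limit of triples of zeros, either three distinct zeros survive, or there is a double zero
together with another zero, or a triple zero (`zeros_of_mem_closure`). In the second case, if the
double zero is not triple, a third zero exists because `g` cannot keep a sign (`exists_third_zero`).
So the closure adds only vertex centres. These lie on the caustic, hence the alternating set is
relatively clopen off the caustic and is there a union of domains. Boundedness is the same limit
argument applied at infinity. -/

theorem eq_zero_of_periodic_of_nonneg_deriv {h g : ℝ → ℝ} {L : ℝ} (hL : 0 < L)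
    (hp : Function.Periodic h L) (hd : ∀ s, HasDerivAt h (g s) s) (hg : ∀ s, 0 ≤ g s) (s : ℝ) :
    g s = 0 := by
  have hm : Monotone h := monotone_of_hasDerivAt_nonneg hd hg
  have hc : ∀ t ∈ Set.Ioo (s - L / 2) (s + L / 2), h t = h s := by
    have key : ∀ x y, s - L / 2 ≤ x → x ≤ y → y ≤ s + L / 2 → h x = h y := by
      intro x y h1 h2 h3
      refine le_antisymm (hm h2) ?_
      rw [← hp x]
      exact hm (by linarith)
    intro t ht
    rcases le_total t s with h' | h'
    · exact key t s ht.1.le h' (by linarith)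
    · exact (key s t (by linarith) h' ht.2.le).symm
  have he : h =ᶠ[𝓝 s] fun _ => h s :=
    Filter.eventually_of_mem (Ioo_mem_nhds (by linarith) (by linarith)) hc
  exact (hd s).unique ((hasDerivAt_const s (h s)).congr_of_eventuallyEq he)

theorem exists_neg_of_periodic {h g : ℝ → ℝ} {L : ℝ} (hL : 0 < L)
    (hp : Function.Periodic h L) (hd : ∀ s, HasDerivAt h (g s) s) (hg : ∃ s, g s ≠ 0) :
    ∃ s, g s < 0 := by
  by_contra! hc
  obtain ⟨s, hs⟩ := hg
  exact hs (eq_zero_of_periodic_of_nonneg_deriv hL hp hd hc s)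

theorem exists_pos_of_periodic {h g : ℝ → ℝ} {L : ℝ} (hL : 0 < L)
    (hp : Function.Periodic h L) (hd : ∀ s, HasDerivAt h (g s) s) (hg : ∃ s, g s ≠ 0) :
    ∃ s, 0 < g s := by
  obtain ⟨s, hs⟩ := exists_neg_of_periodic (h := fun s => -h s) (g := fun s => -g s) hL
    (fun s => by simp [hp s]) (fun s => (hd s).neg) (by simpa using hg)
  exact ⟨s, by simpa using hs⟩

/-- `g` takes values of alternating signs at four points in cyclic order on a period. -/
def Alternates (g : ℝ → ℝ) (L : ℝ) : Prop :=
  ∃ x y z w, x < y ∧ y < z ∧ z < w ∧ w < x + L ∧ g x < 0 ∧ 0 < g y ∧ g z < 0 ∧ 0 < g w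

theorem Alternates.of_neg {g : ℝ → ℝ} {L : ℝ} (hp : Function.Periodic g L)
    (h : Alternates (fun s => -g s) L) : Alternates g L := by
  obtain ⟨x, y, z, w, h1, h2, h3, h4, hx, hy, hz, hw⟩ := h
  -- The pattern is cyclic: a change of sign amounts to starting one point later, and `x` returns as
  -- `x + L`.
  refine ⟨y, z, w, x + L, h2, h3, h4, by linarith, by linarith, by linarith, by linarith, ?_⟩
  rw [hp x]; linarith

theorem exists_sign_change {g : ℝ → ℝ} {d a δ : ℝ} (hg : HasDerivAt g d a) (h0 : g a = 0)
    (hd : 0 < d) (hδ : 0 < δ) :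
    ∃ x y, a - δ < x ∧ x < a ∧ a < y ∧ y < a + δ ∧ g x < 0 ∧ 0 < g y := by
  have hs := eventually_nhds_iff.1 (eventually_nhdsWithin_sign_eq_of_deriv_pos
    (by rwa [hg.deriv]) h0)
  obtain ⟨t, ht, hto, hat⟩ := hs
  obtain ⟨ε, hε, hb⟩ := Metric.isOpen_iff.1 hto a hat
  have hm : 0 < min ε δ / 2 := by positivity
  have h1 : min ε δ / 2 < ε := by linarith [min_le_left ε δ]
  have h2 : min ε δ / 2 < δ := by linarith [min_le_right ε δ]
  refine ⟨a - min ε δ / 2, a + min ε δ / 2, by linarith, by linarith, by linarith, by linarith,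
    ?_, ?_⟩
  · have := ht (a - min ε δ / 2) (hb (by
      rwa [Metric.mem_ball, Real.dist_eq, sub_sub_cancel_left, abs_neg, abs_of_pos hm]))
    rw [sign_neg (by linarith : a - min ε δ / 2 - a < 0)] at this
    exact sign_eq_neg_one_iff.1 this
  · have := ht (a + min ε δ / 2) (hb (by
      rwa [Metric.mem_ball, Real.dist_eq, add_sub_cancel_left, abs_of_pos hm]))
    rw [sign_pos (by linarith : 0 < a + min ε δ / 2 - a)] at this
    exact sign_eq_one_iff.1 this

theorem exists_sign_change_of_neg {g : ℝ → ℝ} {d a δ : ℝ} (hg : HasDerivAt g d a)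
    (h0 : g a = 0) (hd : d < 0) (hδ : 0 < δ) :
    ∃ x y, a - δ < x ∧ x < a ∧ a < y ∧ y < a + δ ∧ 0 < g x ∧ g y < 0 := by
  obtain ⟨x, y, h1, h2, h3, h4, h5, h6⟩ :=
    exists_sign_change (g := fun s => -g s) hg.neg (by simp [h0]) (neg_pos.2 hd) hδ
  exact ⟨x, y, h1, h2, h3, h4, by linarith, by linarith⟩

/-- Of three cyclically ordered crossings, two consecutive ones go in the same direction, and
between these the function must change sign once more. Each case reads four alternating values from
sample points next to the crossings. -/
theorem alternates_of_deriv_pos {g g' : ℝ → ℝ} {L a b c : ℝ} (hp : Function.Periodic g L)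
    (hd : ∀ s, HasDerivAt g (g' s) s) (hab : a < b) (hbc : b < c) (hca : c < a + L)
    (ha : g a = 0) (hb : g b = 0) (hc : g c = 0) (ha' : 0 < g' a) (hb' : g' b ≠ 0)
    (hc' : g' c ≠ 0) : Alternates g L := by
  -- A third of the smallest cyclic gap keeps the windows around the three zeros disjoint.
  obtain ⟨δ, hδ, h1, h2, h3⟩ : ∃ δ, 0 < δ ∧ a + δ < b - δ ∧ b + δ < c - δ ∧ c + δ < a + L - δ := by
    have h1 : 0 < b - a := by linarith
    have h2 : 0 < c - b := by linarith
    have h3 : 0 < a + L - c := by linarith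
    refine ⟨min (b - a) (min (c - b) (a + L - c)) / 3, by positivity, ?_, ?_, ?_⟩ <;>
    linarith [min_le_left (b - a) (min (c - b) (a + L - c)),
      min_le_right (b - a) (min (c - b) (a + L - c)), min_le_left (c - b) (a + L - c),
      min_le_right (c - b) (a + L - c), lt_min h1 (lt_min h2 h3)]
  obtain ⟨x, y, x1, x2, y1, y2, hx, hy⟩ := exists_sign_change (hd a) ha ha' hδ
  rcases hb'.lt_or_gt with hb' | hb'
  · obtain ⟨z, w, z1, z2, w1, w2, hz, hw⟩ := exists_sign_change_of_neg (hd b) hb hb' hδ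
    rcases hc'.lt_or_gt with hc' | hc'
    · obtain ⟨u, v, u1, u2, v1, v2, hu, hv⟩ := exists_sign_change_of_neg (hd c) hc hc' hδ
      refine Alternates.of_neg hp ⟨y, w, u, v, ?_⟩
      refine ⟨?_, ?_, ?_, ?_, ?_, ?_, ?_, ?_⟩ <;> linarith
    · obtain ⟨u, v, u1, u2, v1, v2, hu, hv⟩ := exists_sign_change (hd c) hc hc' hδ
      refine ⟨x, y, w, v, ?_, ?_, ?_, ?_, ?_, ?_, ?_, ?_⟩ <;> linarith
  · obtain ⟨z, w, z1, z2, w1, w2, hz, hw⟩ := exists_sign_change (hd b) hb hb' hδ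
    refine ⟨x, y, z, w, ?_, ?_, ?_, ?_, ?_, ?_, ?_, ?_⟩ <;> linarith

theorem alternates_of_simple_zeros {g g' : ℝ → ℝ} {L a b c : ℝ} (hp : Function.Periodic g L)
    (hd : ∀ s, HasDerivAt g (g' s) s) (hab : a < b) (hbc : b < c) (hca : c < a + L)
    (ha : g a = 0) (hb : g b = 0) (hc : g c = 0) (ha' : g' a ≠ 0) (hb' : g' b ≠ 0)
    (hc' : g' c ≠ 0) : Alternates g L := by
  rcases ha'.lt_or_gt with ha' | ha'
  · refine Alternates.of_neg hp (alternates_of_deriv_pos (g := fun s => -g s)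
      (g' := fun s => -g' s) (fun s => by simp [hp s]) (fun s => (hd s).neg) hab hbc hca ?_ ?_ ?_
      ?_ ?_ ?_) <;> simpa
  · exact alternates_of_deriv_pos hp hd hab hbc hca ha hb hc ha' hb' hc'

theorem Alternates.exists_zeros {g : ℝ → ℝ} {L : ℝ} (hg : Continuous g)
    (hp : Function.Periodic g L) (h : Alternates g L) :
    ∃ a b c d, a < b ∧ b < c ∧ c < d ∧ d < a + L ∧ g a = 0 ∧ g b = 0 ∧ g c = 0 ∧ g d = 0 := by
  obtain ⟨x, y, z, w, h1, h2, h3, h4, hx, hy, hz, hw⟩ := h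
  obtain ⟨a, ⟨a1, a2⟩, ha⟩ := intermediate_value_Ioo h1.le hg.continuousOn ⟨hx, hy⟩
  obtain ⟨b, ⟨b1, b2⟩, hb⟩ := intermediate_value_Ioo' h2.le hg.continuousOn ⟨hz, hy⟩
  obtain ⟨c, ⟨c1, c2⟩, hc⟩ := intermediate_value_Ioo h3.le hg.continuousOn ⟨hz, hw⟩
  obtain ⟨d, ⟨d1, d2⟩, hd⟩ := intermediate_value_Ioo' h4.le hg.continuousOn
    (⟨by rwa [hp x], hw⟩ : (0 : ℝ) ∈ Set.Ioo (g (x + L)) (g w))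
  exact ⟨a, b, c, d, by linarith, by linarith, by linarith, by linarith, ha, hb, hc, hd⟩

theorem pos_on_Ioo {g : ℝ → ℝ} {a b t : ℝ} (hg : Continuous g)
    (h0 : ∀ s ∈ Set.Ioo a b, g s ≠ 0) (ht : t ∈ Set.Ioo a b) (hpos : 0 ≤ g t) :
    ∀ s ∈ Set.Ioo a b, 0 < g s := by
  intro s hs
  by_contra hc
  obtain ⟨r, hr, hr0⟩ := isPreconnected_Ioo.intermediate_value hs ht hg.continuousOn
    (⟨not_lt.1 hc, hpos⟩ : (0 : ℝ) ∈ Set.Icc (g s) (g t))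
  exact h0 r hr hr0

/-- Near the double zero `a` the function is nonnegative on both sides. Without a third zero this
sign propagates over `(a, c)` and `(c, a + L)`, so `g` is nonnegative everywhere; being the
derivative of a periodic function it vanishes, contrary to its positivity on `(a, c)`. -/
theorem exists_third_zero_of_pos {h g g' g'' : ℝ → ℝ} {L a c : ℝ}
    (hp : Function.Periodic h L) (hh : ∀ s, HasDerivAt h (g s) s)
    (hgp : Function.Periodic g L) (hg : ∀ s, HasDerivAt g (g' s) s)
    (hg' : ∀ s, HasDerivAt g' (g'' s) s) (ha : g a = 0) (ha' : g' a = 0) (ha'' : 0 < g'' a)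
    (hac : a < c) (hca : c < a + L) (hc : g c = 0) :
    ∃ d ∈ Set.Ioo a (a + L), d ≠ c ∧ g d = 0 := by
  by_contra! hne
  have hcont : Continuous g := continuous_iff_continuousAt.2 fun s => (hg s).continuousAt
  have hdg : deriv g = g' := funext fun s => (hg s).deriv
  have hmin : IsLocalMin g a := isLocalMin_of_deriv_deriv_pos
    (by rw [hdg, (hg' a).deriv]; exact ha'') (by rw [hdg, ha']) hcont.continuousAt
  obtain ⟨ε, hε, hb⟩ := Metric.eventually_nhds_iff.1 hmin
  obtain ⟨δ, hδ, h1, h2, h3⟩ : ∃ δ, 0 < δ ∧ δ < ε ∧ a + δ < c ∧ c < a + L - δ := by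
    have h1 : 0 < c - a := by linarith
    have h3 : 0 < a + L - c := by linarith
    refine ⟨min ε (min (c - a) (a + L - c)) / 2, by positivity, ?_, ?_, ?_⟩ <;>
    linarith [min_le_left ε (min (c - a) (a + L - c)),
      min_le_right ε (min (c - a) (a + L - c)), min_le_left (c - a) (a + L - c),
      min_le_right (c - a) (a + L - c), lt_min hε (lt_min h1 h3)]
  have hr : 0 ≤ g (a + δ) := by
    have := hb (y := a + δ) (by simp [abs_of_pos hδ, h1])
    linarith
  have hl : 0 ≤ g (a + L - δ) := by
    have := hb (y := a - δ) (by simp [abs_of_pos hδ, h1])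
    rw [show a + L - δ = a - δ + L by ring, hgp]
    linarith
  have hpos1 := pos_on_Ioo hcont
    (fun s (hs : s ∈ Set.Ioo a c) => hne s ⟨hs.1, by linarith [hs.2]⟩ hs.2.ne)
    ⟨by linarith, h2⟩ hr
  have hpos2 := pos_on_Ioo hcont
    (fun s (hs : s ∈ Set.Ioo c (a + L)) => hne s ⟨by linarith [hs.1], hs.2⟩ hs.1.ne')
    ⟨h3, by linarith⟩ hl
  have hL : 0 < L := by linarith
  have hnn : ∀ s, 0 ≤ g s := by
    intro s
    obtain ⟨t, ht, hst⟩ := hgp.exists_mem_Ico hL s a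
    rw [hst]
    rcases ht.1.eq_or_lt with e | e
    · rw [← e, ha]
    · rcases lt_trichotomy t c with h | h | h
      · exact (hpos1 t ⟨e, h⟩).le
      · rw [h, hc]
      · exact (hpos2 t ⟨h, ht.2⟩).le
  have := hpos1 (a + δ) ⟨by linarith, h2⟩
  rw [eq_zero_of_periodic_of_nonneg_deriv hL hp hh hnn] at this
  exact this.false

theorem exists_third_zero {h g g' g'' : ℝ → ℝ} {L a c : ℝ}
    (hp : Function.Periodic h L) (hh : ∀ s, HasDerivAt h (g s) s)
    (hgp : Function.Periodic g L) (hg : ∀ s, HasDerivAt g (g' s) s)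
    (hg' : ∀ s, HasDerivAt g' (g'' s) s) (ha : g a = 0) (ha' : g' a = 0) (ha'' : g'' a ≠ 0)
    (hac : a < c) (hca : c < a + L) (hc : g c = 0) :
    ∃ d ∈ Set.Ioo a (a + L), d ≠ c ∧ g d = 0 := by
  rcases ha''.lt_or_gt with ha'' | ha''
  · obtain ⟨d, h1, h2, h3⟩ := exists_third_zero_of_pos (h := fun s => -h s) (g := fun s => -g s)
      (g' := fun s => -g' s) (g'' := fun s => -g'' s) (fun s => by simp [hp s])
      (fun s => (hh s).neg) (fun s => by simp [hgp s]) (fun s => (hg s).neg)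
      (fun s => (hg' s).neg) (by simpa) (by simpa) (by simpa) hac hca (by simpa)
    exact ⟨d, h1, h2, by simpa using h3⟩
  · exact exists_third_zero_of_pos hp hh hgp hg hg' ha ha' ha'' hac hca hc

/-! ### Limits of triples of zeros -/

theorem exists_tendsto_zero_deriv {X : Type*} {F F' : X → ℝ → ℝ} {x : ℕ → X}
    {u v : ℕ → ℝ} {a : ℝ} (hd : ∀ y s, HasDerivAt (F y) (F' y s) s) (huv : ∀ n, u n < v n)
    (hu : ∀ n, F (x n) (u n) = 0) (hv : ∀ n, F (x n) (v n) = 0)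
    (hua : Tendsto u atTop (𝓝 a)) (hva : Tendsto v atTop (𝓝 a)) :
    ∃ r : ℕ → ℝ, (∀ n, u n < r n ∧ r n < v n) ∧ (∀ n, F' (x n) (r n) = 0) ∧
      Tendsto r atTop (𝓝 a) := by
  have key : ∀ n, ∃ r ∈ Set.Ioo (u n) (v n), F' (x n) r = 0 := fun n =>
    exists_hasDerivAt_eq_zero (huv n)
      (fun s _ => (hd (x n) s).continuousAt.continuousWithinAt) (by rw [hu, hv])
      fun s _ => hd (x n) s
  choose r hr hr0 using key
  exact ⟨r, hr, hr0, tendsto_of_tendsto_of_tendsto_of_le_of_le hua hva (fun n => (hr n).1.le)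
    fun n => (hr n).2.le⟩

theorem eq_zero_of_tendsto {X : Type*} [TopologicalSpace X] {F : X → ℝ → ℝ}
    (hF : Continuous fun p : X × ℝ => F p.1 p.2) {x : ℕ → X} {x₀ : X} {u : ℕ → ℝ} {a : ℝ}
    (hx : Tendsto x atTop (𝓝 x₀)) (hu : Tendsto u atTop (𝓝 a)) (h0 : ∀ n, F (x n) (u n) = 0) :
    F x₀ a = 0 := by
  have h1 : Tendsto (fun n => F (x n) (u n)) atTop (𝓝 (F x₀ a)) :=
    (hF.tendsto (x₀, a)).comp (hx.prodMk_nhds hu)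
  simp only [h0] at h1
  exact tendsto_nhds_unique h1 tendsto_const_nhds

/-- `g` has three zeros in cyclic order on a period. -/
def HasThreeZeros (g : ℝ → ℝ) (L : ℝ) : Prop :=
  ∃ a b c, a < b ∧ b < c ∧ c < a + L ∧ g a = 0 ∧ g b = 0 ∧ g c = 0

/-- Rolle's theorem places a zero of `F'` between merging zeros of `F`, and a zero of `F''` when
three merge; these persist in the limit. -/
theorem double_or_triple_zero_of_tendsto {X : Type*} [TopologicalSpace X] {F F' F'' : X → ℝ → ℝ}
    {L : ℝ} (hF : Continuous fun p : X × ℝ => F p.1 p.2)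
    (hF' : Continuous fun p : X × ℝ => F' p.1 p.2)
    (hF'' : Continuous fun p : X × ℝ => F'' p.1 p.2)
    (hd : ∀ y s, HasDerivAt (F y) (F' y s) s) (hd' : ∀ y s, HasDerivAt (F' y) (F'' y s) s)
    (hp : ∀ y, Function.Periodic (F y) L) {x : ℕ → X} {x₀ : X} (hx : Tendsto x atTop (𝓝 x₀))
    {u v w : ℕ → ℝ} (huv : ∀ n, u n < v n) (hvw : ∀ n, v n < w n) (hwu : ∀ n, w n < u n + L)
    (hu : ∀ n, F (x n) (u n) = 0) (hv : ∀ n, F (x n) (v n) = 0) (hw : ∀ n, F (x n) (w n) = 0)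
    {a c : ℝ} (hua : Tendsto u atTop (𝓝 a)) (hva : Tendsto v atTop (𝓝 a))
    (hwc : Tendsto w atTop (𝓝 c)) :
    ∃ a, F x₀ a = 0 ∧ F' x₀ a = 0 ∧
      ((∃ c, a < c ∧ c < a + L ∧ F x₀ c = 0) ∨ F'' x₀ a = 0) := by
  have triple : ∀ u v w : ℕ → ℝ, (∀ n, u n < v n) → (∀ n, v n < w n) →
      (∀ n, F (x n) (u n) = 0) → (∀ n, F (x n) (v n) = 0) → (∀ n, F (x n) (w n) = 0) →
      Tendsto u atTop (𝓝 a) → Tendsto v atTop (𝓝 a) → Tendsto w atTop (𝓝 a) →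
      F'' x₀ a = 0 := by
    intro u v w huv hvw hu hv hw hua hva hwa
    obtain ⟨r, hr, hr0, hra⟩ := exists_tendsto_zero_deriv hd huv hu hv hua hva
    obtain ⟨t, ht, ht0, hta⟩ := exists_tendsto_zero_deriv hd hvw hv hw hva hwa
    obtain ⟨q, hq, hq0, hqa⟩ := exists_tendsto_zero_deriv hd'
      (fun n => (hr n).2.trans (ht n).1) hr0 ht0 hra hta
    exact eq_zero_of_tendsto hF'' hx hqa hq0
  obtain ⟨r, hr, hr0, hra⟩ := exists_tendsto_zero_deriv hd huv hu hv hua hva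
  refine ⟨a, eq_zero_of_tendsto hF hx hua hu, eq_zero_of_tendsto hF' hx hra hr0, ?_⟩
  have hac : a ≤ c := le_of_tendsto_of_tendsto' hva hwc fun n => (hvw n).le
  have hca : c ≤ a + L := le_of_tendsto_of_tendsto' hwc (hua.add_const L) fun n => (hwu n).le
  rcases hac.eq_or_lt with rfl | hac
  · exact Or.inr (triple u v w huv hvw hu hv hw hua hva hwc)
  rcases hca.eq_or_lt with rfl | hca
  -- Here the third zero reaches `a` from the other side of the period, so it is moved back by `L`.
  · refine Or.inr (triple (fun n => w n - L) u v (fun n => by linarith [hwu n]) huv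
      (fun n => by rw [(hp _).sub_eq, hw]) hu hv ?_ hua hva)
    simpa using hwc.sub_const L
  · exact Or.inl ⟨c, hac, hca, eq_zero_of_tendsto hF hx hwc hw⟩

/-- Compactness of the set of triples modulo the period gives a convergent subsequence. The
parameter space is left general so that it can include directions at infinity as well as points of
the plane. -/
theorem zeros_of_mem_closure {X : Type*} [TopologicalSpace X] [FrechetUrysohnSpace X]
    {F F' F'' : X → ℝ → ℝ} {L : ℝ} (hL : 0 < L) (hF : Continuous fun p : X × ℝ => F p.1 p.2)
    (hF' : Continuous fun p : X × ℝ => F' p.1 p.2)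
    (hF'' : Continuous fun p : X × ℝ => F'' p.1 p.2)
    (hd : ∀ y s, HasDerivAt (F y) (F' y s) s) (hd' : ∀ y s, HasDerivAt (F' y) (F'' y s) s)
    (hp : ∀ y, Function.Periodic (F y) L) {x₀ : X}
    (hx₀ : x₀ ∈ closure {y | HasThreeZeros (F y) L}) :
    HasThreeZeros (F x₀) L ∨ ∃ a, F x₀ a = 0 ∧ F' x₀ a = 0 ∧
      ((∃ c, a < c ∧ c < a + L ∧ F x₀ c = 0) ∨ F'' x₀ a = 0) := by
  obtain ⟨x, hxS, hx⟩ := mem_closure_iff_seq_limit.1 hx₀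
  have key : ∀ n, ∃ p : ℝ × ℝ × ℝ, p ∈ Set.Icc (0 : ℝ × ℝ × ℝ) (2 * L, 2 * L, 2 * L) ∧
      p.1 < p.2.1 ∧ p.2.1 < p.2.2 ∧ p.2.2 < p.1 + L ∧ F (x n) p.1 = 0 ∧ F (x n) p.2.1 = 0 ∧
      F (x n) p.2.2 = 0 := by
    intro n
    obtain ⟨a, b, c, hab, hbc, hca, ha, hb, hc⟩ := hxS n
    -- A common shift puts the first zero in `[0, L)`, hence all three in `[0, 2L]`.
    obtain ⟨k, ⟨hk1, hk2⟩, -⟩ := existsUnique_add_zsmul_mem_Ico hL a 0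
    have hpk : ∀ s, F (x n) (s + k • L) = F (x n) s := fun s => ((hp (x n)).zsmul k) s
    refine ⟨(a + k • L, b + k • L, c + k • L), ?_, by simpa, by simpa, ?_, ?_, ?_, ?_⟩
    · simp only [Set.mem_Icc, Prod.le_def, Prod.fst_zero, Prod.snd_zero]
      refine ⟨⟨?_, ?_, ?_⟩, ?_, ?_, ?_⟩ <;> linarith
    · show c + k • L < a + k • L + L
      linarith
    · simpa only [hpk] using ha
    · simpa only [hpk] using hb
    · simpa only [hpk] using hc
  choose p hpI h1 h2 h3 hu hv hw using key
  obtain ⟨⟨a, b, c⟩, -, φ, hφ, hlim⟩ := isCompact_Icc.tendsto_subseq hpI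
  have hx' := hx.comp hφ.tendsto_atTop
  have ha : Tendsto (fun n => (p (φ n)).1) atTop (𝓝 a) := (continuous_fst.tendsto _).comp hlim
  have hb : Tendsto (fun n => (p (φ n)).2.1) atTop (𝓝 b) :=
    ((continuous_fst.comp continuous_snd).tendsto (a, b, c)).comp hlim
  have hc : Tendsto (fun n => (p (φ n)).2.2) atTop (𝓝 c) :=
    ((continuous_snd.comp continuous_snd).tendsto (a, b, c)).comp hlim
  have hab : a ≤ b := le_of_tendsto_of_tendsto' ha hb fun n => (h1 _).le
  have hbc : b ≤ c := le_of_tendsto_of_tendsto' hb hc fun n => (h2 _).le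
  have hca : c ≤ a + L := le_of_tendsto_of_tendsto' hc (ha.add_const L) fun n => (h3 _).le
  rcases hab.eq_or_lt with rfl | hab
  · exact Or.inr (double_or_triple_zero_of_tendsto hF hF' hF'' hd hd' hp hx' (fun n => h1 _)
      (fun n => h2 _) (fun n => h3 _) (fun n => hu _) (fun n => hv _) (fun n => hw _) ha hb hc)
  -- The other two possible mergers reduce to the first by rotating the triple cyclically.
  rcases hbc.eq_or_lt with rfl | hbc
  · exact Or.inr (double_or_triple_zero_of_tendsto hF hF' hF'' hd hd' hp hx' (fun n => h2 _)
      (fun n => h3 _) (fun n => by linarith [h1 (φ n)]) (fun n => hv _) (fun n => hw _)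
      (fun n => by rw [hp]; exact hu _) hb hc (ha.add_const L))
  rcases hca.eq_or_lt with rfl | hca
  · exact Or.inr (double_or_triple_zero_of_tendsto hF hF' hF'' hd hd' hp hx' (fun n => h3 _)
      (fun n => by linarith [h1 (φ n)]) (fun n => by linarith [h2 (φ n)]) (fun n => hw _)
      (fun n => by rw [hp]; exact hu _) (fun n => by rw [hp]; exact hv _) hc
      (ha.add_const L) (hb.add_const L))
  · exact Or.inl ⟨a, b, c, hab, hbc, hca, eq_zero_of_tendsto hF hx' ha fun n => hu _,
      eq_zero_of_tendsto hF hx' hb fun n => hv _, eq_zero_of_tendsto hF hx' hc fun n => hw _⟩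

/-! ### The moving frame -/

theorem inner_eq (v w : Plane) : inner ℝ v w = v 0 * w 0 + v 1 * w 1 := by
  simp [PiLp.inner_apply, Fin.sum_univ_two, mul_comm]

theorem tangent_sq {γ : ℝ → Plane} {L : ℝ} (hγ : IsClosedConvexCurve γ L) (s : ℝ) :
    tangent γ s 0 ^ 2 + tangent γ s 1 ^ 2 = 1 := by
  have h := real_inner_self_eq_norm_sq (tangent γ s)
  rw [hγ.unit_speed, inner_eq] at h
  linarith

theorem normal_zero (γ : ℝ → Plane) (s : ℝ) : normal γ s 0 = -tangent γ s 1 := rfl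

theorem normal_one (γ : ℝ → Plane) (s : ℝ) : normal γ s 1 = tangent γ s 0 := rfl

theorem inner_tangent_normal (γ : ℝ → Plane) (s : ℝ) :
    inner ℝ (tangent γ s) (normal γ s) = 0 := by
  rw [inner_eq, normal_zero, normal_one]; ring

theorem inner_tangent_tangent {γ : ℝ → Plane} {L : ℝ} (hγ : IsClosedConvexCurve γ L) (s : ℝ) :
    inner ℝ (tangent γ s) (tangent γ s) = 1 := by
  rw [inner_eq, ← tangent_sq hγ s]; ring

theorem inner_normal_normal {γ : ℝ → Plane} {L : ℝ} (hγ : IsClosedConvexCurve γ L) (s : ℝ) :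
    inner ℝ (normal γ s) (normal γ s) = 1 := by
  rw [inner_eq, normal_zero, normal_one, ← tangent_sq hγ s]; ring

theorem eq_inner_smul_add {γ : ℝ → Plane} {L : ℝ} (hγ : IsClosedConvexCurve γ L) (s : ℝ)
    (v : Plane) :
    v = inner ℝ v (tangent γ s) • tangent γ s + inner ℝ v (normal γ s) • normal γ s := by
  have h := tangent_sq hγ s
  ext i
  fin_cases i
  · simp only [Fin.zero_eta, PiLp.add_apply, PiLp.smul_apply, smul_eq_mul, inner_eq, normal_zero,
      normal_one]
    linear_combination (-(v 0)) * h
  · simp only [Fin.mk_one, PiLp.add_apply, PiLp.smul_apply, smul_eq_mul, inner_eq, normal_zero,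
      normal_one]
    linear_combination (-(v 1)) * h

theorem eq_inner_smul_normal {γ : ℝ → Plane} {L : ℝ} (hγ : IsClosedConvexCurve γ L) {s : ℝ}
    {v : Plane} (h : inner ℝ v (tangent γ s) = 0) :
    v = inner ℝ v (normal γ s) • normal γ s := by
  conv_lhs => rw [eq_inner_smul_add hγ s v, h, zero_smul, zero_add]

theorem eq_zero_of_inner {γ : ℝ → Plane} {L : ℝ} (hγ : IsClosedConvexCurve γ L) {s : ℝ}
    {v : Plane} (h : inner ℝ v (tangent γ s) = 0) (h' : inner ℝ v (normal γ s) = 0) : v = 0 := by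
  rw [eq_inner_smul_normal hγ h, h', zero_smul]

theorem contDiff_tangent {γ : ℝ → Plane} {L : ℝ} (hγ : IsClosedConvexCurve γ L) :
    ContDiff ℝ ∞ (tangent γ) := (contDiff_infty_iff_deriv.1 hγ.smooth).2

theorem contDiff_normal {γ : ℝ → Plane} {L : ℝ} (hγ : IsClosedConvexCurve γ L) :
    ContDiff ℝ ∞ (normal γ) := by
  have h := contDiff_euclidean.1 (contDiff_tangent hγ)
  refine contDiff_euclidean.2 fun i => ?_
  fin_cases i
  · exact (h 1).neg
  · exact h 0

theorem contDiff_curvature {γ : ℝ → Plane} {L : ℝ} (hγ : IsClosedConvexCurve γ L) :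
    ContDiff ℝ ∞ (curvature γ) :=
  (contDiff_infty_iff_deriv.1 (contDiff_tangent hγ)).2.inner ℝ (contDiff_normal hγ)

theorem hasDerivAt_curve {γ : ℝ → Plane} {L : ℝ} (hγ : IsClosedConvexCurve γ L) (s : ℝ) :
    HasDerivAt γ (tangent γ s) s :=
  ((contDiff_infty_iff_deriv.1 hγ.smooth).1 s).hasDerivAt

theorem hasDerivAt_tangent {γ : ℝ → Plane} {L : ℝ} (hγ : IsClosedConvexCurve γ L) (s : ℝ) :
    HasDerivAt (tangent γ) (curvature γ s • normal γ s) s := by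
  have hd := ((contDiff_infty_iff_deriv.1 (contDiff_tangent hγ)).1 s).hasDerivAt
  have h0 : inner ℝ (deriv (tangent γ) s) (tangent γ s) = 0 := by
    have h1 := hd.inner ℝ hd
    have h2 : (fun t => inner ℝ (tangent γ t) (tangent γ t)) = fun _ => (1 : ℝ) :=
      funext (inner_tangent_tangent hγ)
    rw [h2] at h1
    have h3 := h1.unique (hasDerivAt_const s 1)
    rw [real_inner_comm] at h3
    linarith
  have := eq_inner_smul_normal hγ h0
  rw [this] at hd
  exact hd

theorem hasDerivAt_plane_iff {f : ℝ → Plane} {f' : Plane} {s : ℝ} :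
    HasDerivAt f f' s ↔ ∀ i, HasDerivAt (fun t => f t i) (f' i) s := by
  rw [← hasDerivWithinAt_univ, hasDerivWithinAt_iff_hasFDerivWithinAt,
    hasFDerivWithinAt_euclidean]
  refine forall_congr' fun i => ?_
  rw [← hasDerivWithinAt_univ, hasDerivWithinAt_iff_hasFDerivWithinAt]
  refine iff_of_eq (congrArg (fun A => HasFDerivWithinAt _ A _ _) ?_)
  ext
  simp

theorem hasDerivAt_normal {γ : ℝ → Plane} {L : ℝ} (hγ : IsClosedConvexCurve γ L) (s : ℝ) :
    HasDerivAt (normal γ) (-curvature γ s • tangent γ s) s := by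
  have h := hasDerivAt_plane_iff.1 (hasDerivAt_tangent hγ s)
  refine hasDerivAt_plane_iff.2 fun i => ?_
  fin_cases i
  · exact (h 1).neg.congr_deriv (by simp [normal_one])
  · exact (h 0).congr_deriv (by simp [normal_zero])

theorem hasDerivAt_curvature {γ : ℝ → Plane} {L : ℝ} (hγ : IsClosedConvexCurve γ L) (s : ℝ) :
    HasDerivAt (curvature γ) (deriv (curvature γ) s) s :=
  ((contDiff_infty_iff_deriv.1 (contDiff_curvature hγ)).1 s).hasDerivAt

theorem periodic_tangent {γ : ℝ → Plane} {L : ℝ} (hγ : IsClosedConvexCurve γ L) :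
    Function.Periodic (tangent γ) L := fun s => by
  have h : HasDerivAt γ (tangent γ (s + L)) s := by
    have := (hasDerivAt_curve hγ (s + L)).comp_add_const s L
    rwa [show (fun x => γ (x + L)) = γ from funext hγ.periodic] at this
  exact h.unique (hasDerivAt_curve hγ s)

/-! ### The pedal family and its derivatives -/

/-- The height functions (`p.1 = 0`) and the derivatives of the distance functions (`p.1 = 1`)
along the curve, in one family. -/
def pedal (γ : ℝ → Plane) (p : ℝ × Plane) (s : ℝ) : ℝ :=
  inner ℝ (p.2 - p.1 • γ s) (tangent γ s)

/-- The derivative of `pedal γ p`. -/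
def pedal' (γ : ℝ → Plane) (p : ℝ × Plane) (s : ℝ) : ℝ :=
  curvature γ s * inner ℝ (p.2 - p.1 • γ s) (normal γ s) - p.1

/-- The second derivative of `pedal γ p`. -/
def pedal'' (γ : ℝ → Plane) (p : ℝ × Plane) (s : ℝ) : ℝ :=
  deriv (curvature γ) s * inner ℝ (p.2 - p.1 • γ s) (normal γ s) -
    curvature γ s ^ 2 * inner ℝ (p.2 - p.1 • γ s) (tangent γ s)

theorem hasDerivAt_sub_smul_curve {γ : ℝ → Plane} {L : ℝ} (hγ : IsClosedConvexCurve γ L)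
    (p : ℝ × Plane) (s : ℝ) :
    HasDerivAt (fun s => p.2 - p.1 • γ s) (-(p.1 • tangent γ s)) s :=
  ((hasDerivAt_curve hγ s).const_smul p.1).const_sub p.2

theorem hasDerivAt_pedal {γ : ℝ → Plane} {L : ℝ} (hγ : IsClosedConvexCurve γ L)
    (p : ℝ × Plane) (s : ℝ) :
    HasDerivAt (pedal γ p) (pedal' γ p s) s := by
  refine ((hasDerivAt_sub_smul_curve hγ p s).inner ℝ (hasDerivAt_tangent hγ s)).congr_deriv ?_
  rw [pedal', inner_smul_right, inner_neg_left, inner_smul_left, inner_tangent_tangent hγ]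
  simp [sub_eq_add_neg]

theorem hasDerivAt_pedal' {γ : ℝ → Plane} {L : ℝ} (hγ : IsClosedConvexCurve γ L)
    (p : ℝ × Plane) (s : ℝ) :
    HasDerivAt (pedal' γ p) (pedal'' γ p s) s := by
  refine (((hasDerivAt_curvature hγ s).mul ((hasDerivAt_sub_smul_curve hγ p s).inner ℝ
    (hasDerivAt_normal hγ s))).sub_const p.1).congr_deriv ?_
  rw [pedal'', inner_smul_right, inner_neg_left, inner_smul_left, inner_tangent_normal]
  simp
  ring

theorem continuous_sub_smul_curve {γ : ℝ → Plane} {L : ℝ} (hγ : IsClosedConvexCurve γ L) :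
    Continuous fun q : (ℝ × Plane) × ℝ => q.1.2 - q.1.1 • γ q.2 := by
  have := hγ.smooth.continuous
  fun_prop

theorem continuous_pedal {γ : ℝ → Plane} {L : ℝ} (hγ : IsClosedConvexCurve γ L) :
    Continuous fun q : (ℝ × Plane) × ℝ => pedal γ q.1 q.2 :=
  (continuous_sub_smul_curve hγ).inner ((contDiff_tangent hγ).continuous.comp continuous_snd)

theorem continuous_pedal' {γ : ℝ → Plane} {L : ℝ} (hγ : IsClosedConvexCurve γ L) :
    Continuous fun q : (ℝ × Plane) × ℝ => pedal' γ q.1 q.2 :=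
  (((contDiff_curvature hγ).continuous.comp continuous_snd).mul
    ((continuous_sub_smul_curve hγ).inner
      ((contDiff_normal hγ).continuous.comp continuous_snd))).sub
    (continuous_fst.comp continuous_fst)

theorem continuous_pedal'' {γ : ℝ → Plane} {L : ℝ} (hγ : IsClosedConvexCurve γ L) :
    Continuous fun q : (ℝ × Plane) × ℝ => pedal'' γ q.1 q.2 := by
  have h1 := (contDiff_infty_iff_deriv.1 (contDiff_curvature hγ)).2.continuous
  have h2 := (contDiff_curvature hγ).continuous
  exact ((h1.comp continuous_snd).mul ((continuous_sub_smul_curve hγ).inner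
    ((contDiff_normal hγ).continuous.comp continuous_snd))).sub
    (((h2.comp continuous_snd).pow 2).mul ((continuous_sub_smul_curve hγ).inner
    ((contDiff_tangent hγ).continuous.comp continuous_snd)))

theorem periodic_pedal {γ : ℝ → Plane} {L : ℝ} (hγ : IsClosedConvexCurve γ L)
    (p : ℝ × Plane) : Function.Periodic (pedal γ p) L := fun s => by
  rw [pedal, pedal, hγ.periodic, periodic_tangent hγ]

theorem hasDerivAt_sq_dist {γ : ℝ → Plane} {L : ℝ} (hγ : IsClosedConvexCurve γ L)
    (Q : Plane) (s : ℝ) :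
    HasDerivAt (fun s => -(inner ℝ (Q - γ s) (Q - γ s) / 2)) (pedal γ (1, Q) s) s := by
  have h := (hasDerivAt_curve hγ s).const_sub Q
  refine ((h.inner ℝ h).div_const 2).neg.congr_deriv ?_
  rw [pedal, inner_neg_left, inner_neg_right, real_inner_comm (Q - γ s)]
  simp only [one_smul]
  ring

theorem periodic_sq_dist {γ : ℝ → Plane} {L : ℝ} (hγ : IsClosedConvexCurve γ L)
    (Q : Plane) :
    Function.Periodic (fun s => -(inner ℝ (Q - γ s) (Q - γ s) / 2)) L := fun s => by
  simp only [hγ.periodic s]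

theorem pedal_one (γ : ℝ → Plane) (Q : Plane) (s : ℝ) :
    pedal γ (1, Q) s = inner ℝ (Q - γ s) (tangent γ s) := by simp [pedal]

/-! ### Injectivity on a period -/

theorem curve_ne {γ : ℝ → Plane} {L : ℝ} (hγ : IsClosedConvexCurve γ L)
     {a b : ℝ} (hab : a < b) (hba : b < a + L) : γ a ≠ γ b := by
  intro h
  obtain ⟨k, ⟨hk1, hk2⟩, -⟩ := existsUnique_add_zsmul_mem_Ico hγ.length_pos a 0
  have hpk : ∀ s, γ (s + k • L) = γ s := fun s => (hγ.periodic.zsmul k) s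
  rcases lt_or_ge (b + k • L) L with hb | hb
  · have := hγ.simple (x₁ := a + k • L) (x₂ := b + k • L) ⟨hk1, by linarith⟩
      ⟨by linarith, hb⟩ (by rw [hpk, hpk, h])
    linarith
  · have := hγ.simple (x₁ := a + k • L) (x₂ := b + k • L - L) ⟨hk1, by linarith⟩
      ⟨by linarith, by linarith⟩ (by rw [hpk, hγ.periodic.sub_eq, hpk, h])
    linarith

theorem mem_feet_of_pedal {γ : ℝ → Plane}
     {Q : Plane} {s : ℝ} (h : pedal γ (1, Q) s = 0) : γ s ∈ feet γ Q :=
  ⟨s, rfl, by rwa [pedal_one] at h⟩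

theorem exists_pedal_of_mem_feet {γ : ℝ → Plane} {L : ℝ} (hγ : IsClosedConvexCurve γ L)
     {Q P : Plane} (h : P ∈ feet γ Q) :
    ∃ s ∈ Set.Ico 0 L, γ s = P ∧ pedal γ (1, Q) s = 0 := by
  obtain ⟨s, rfl, hs⟩ := h
  obtain ⟨k, hk, -⟩ := existsUnique_add_zsmul_mem_Ico hγ.length_pos s 0
  rw [zero_add] at hk
  refine ⟨s + k • L, hk, (hγ.periodic.zsmul k) s, ?_⟩
  rw [((periodic_pedal hγ _).zsmul k) s, pedal_one, hs]

theorem mem_orthotricentres_iff_card {γ : ℝ → Plane} {Q : Plane} :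
    Q ∈ orthotricentres γ ↔ 3 ≤ numNormals γ Q := by
  constructor
  · rintro ⟨T, hT, hTQ⟩
    have := Set.encard_le_encard (s := (T : Set Plane)) (t := feet γ Q) hTQ
    rw [Set.encard_coe_eq_coe_finsetCard, hT] at this
    exact this
  · intro h
    obtain ⟨t, ht, hc⟩ := Set.exists_subset_encard_eq h
    have hf : t.Finite := Set.finite_of_encard_eq_coe hc
    refine ⟨hf.toFinset, ?_, fun P hP => ht (hf.mem_toFinset.1 hP)⟩
    rw [hf.encard_eq_coe_toFinset_card] at hc
    exact_mod_cast hc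

theorem mem_orthotricentres_iff {γ : ℝ → Plane} {L : ℝ} (hγ : IsClosedConvexCurve γ L)
     {Q : Plane} :
    Q ∈ orthotricentres γ ↔ HasThreeZeros (pedal γ (1, Q)) L := by
  constructor
  · rintro ⟨T, hT, hTQ⟩
    obtain ⟨A, B, C, hAB, hAC, hBC, rfl⟩ := Finset.card_eq_three.1 hT
    obtain ⟨a, ⟨a0, aL⟩, rfl, ha⟩ := exists_pedal_of_mem_feet hγ (hTQ A (by simp))
    obtain ⟨b, ⟨b0, bL⟩, rfl, hb⟩ := exists_pedal_of_mem_feet hγ (hTQ B (by simp))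
    obtain ⟨c, ⟨c0, cL⟩, rfl, hc⟩ := exists_pedal_of_mem_feet hγ (hTQ C (by simp))
    have hab : a ≠ b := fun h => hAB (by rw [h])
    have hac : a ≠ c := fun h => hAC (by rw [h])
    have hbc : b ≠ c := fun h => hBC (by rw [h])
    rcases hab.lt_or_gt with h1 | h1 <;> rcases hac.lt_or_gt with h2 | h2 <;>
      rcases hbc.lt_or_gt with h3 | h3
    · exact ⟨a, b, c, h1, h3, by linarith, ha, hb, hc⟩
    · exact ⟨a, c, b, h2, h3, by linarith, ha, hc, hb⟩
    · linarith
    · exact ⟨c, a, b, h2, h1, by linarith, hc, ha, hb⟩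
    · exact ⟨b, a, c, h1, h2, by linarith, hb, ha, hc⟩
    · linarith
    · exact ⟨b, c, a, h3, h2, by linarith, hb, hc, ha⟩
    · exact ⟨c, b, a, h3, h1, by linarith, hc, hb, ha⟩
  · rintro ⟨a, b, c, hab, hbc, hca, ha, hb, hc⟩
    refine ⟨{γ a, γ b, γ c}, Finset.card_eq_three.2 ⟨γ a, γ b, γ c,
      curve_ne hγ hab (by linarith), curve_ne hγ (by linarith) hca,
      curve_ne hγ hbc (by linarith), rfl⟩, ?_⟩
    intro P hP
    simp only [Finset.mem_insert, Finset.mem_singleton] at hP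
    rcases hP with rfl | rfl | rfl <;> apply mem_feet_of_pedal <;> assumption

theorem four_le_numNormals {γ : ℝ → Plane} {L : ℝ} (hγ : IsClosedConvexCurve γ L)
     {Q : Plane} (h : Alternates (pedal γ (1, Q)) L) :
    4 ≤ numNormals γ Q := by
  obtain ⟨a, b, c, d, hab, hbc, hcd, hda, ha, hb, hc, hd⟩ := h.exists_zeros
    (continuous_iff_continuousAt.2 fun s => (hasDerivAt_pedal hγ _ s).continuousAt)
    (periodic_pedal hγ _)
  have hs : ({γ a, γ b, γ c, γ d} : Set Plane) ⊆ feet γ Q := by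
    rintro P (rfl | rfl | rfl | rfl) <;> apply mem_feet_of_pedal <;> assumption
  refine le_trans (le_of_eq ?_) (Set.encard_le_encard hs)
  have h1 := curve_ne hγ hab (by linarith)
  have h2 := curve_ne hγ (hab.trans hbc) (by linarith)
  have h3 := curve_ne hγ (hab.trans (hbc.trans hcd)) (by linarith)
  have h4 := curve_ne hγ hbc (by linarith)
  have h5 := curve_ne hγ (hbc.trans hcd) (by linarith)
  have h6 := curve_ne hγ hcd (by linarith)
  rw [Set.encard_insert_of_notMem (by simp [h1, h2, h3]),
    Set.encard_insert_of_notMem (by simp [h4, h5]), Set.encard_pair h6]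
  norm_num

/-! ### Consequences of convexity -/

/-- The height of the curve over its tangent line at `s` has a critical zero at `s` with second
derivative `curvature γ s`. If convexity gave the opposite sign, the second derivative test would
make the height vanish near `s`, forcing zero curvature. -/
theorem curvature_mul_inner_nonneg {γ : ℝ → Plane} {L : ℝ} (hγ : IsClosedConvexCurve γ L)
    (s t : ℝ) : 0 ≤ curvature γ s * inner ℝ (γ t - γ s) (normal γ s) := by
  have hd1 : ∀ t, HasDerivAt (fun t => inner ℝ (γ t - γ s) (normal γ s))
      (inner ℝ (tangent γ t) (normal γ s)) t := fun t =>
    (((hasDerivAt_curve hγ t).sub_const (γ s)).inner ℝ (hasDerivAt_const t (normal γ s))).congr_deriv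
      (by simp)
  have hd2 : HasDerivAt (fun t => inner ℝ (tangent γ t) (normal γ s)) (curvature γ s) s :=
    ((hasDerivAt_tangent hγ s).inner ℝ (hasDerivAt_const s (normal γ s))).congr_deriv
      (by rw [inner_smul_left, inner_normal_normal hγ]; simp)
  have e1 : deriv (fun t => inner ℝ (γ t - γ s) (normal γ s)) =
      fun t => inner ℝ (tangent γ t) (normal γ s) := funext fun t => (hd1 t).deriv
  have e2 : deriv (deriv (fun t => inner ℝ (γ t - γ s) (normal γ s))) s = curvature γ s := by
    rw [e1, hd2.deriv]
  have e3 : deriv (fun t => inner ℝ (γ t - γ s) (normal γ s)) s = 0 := by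
    rw [e1]; exact inner_tangent_normal γ s
  have hflat : (∀ᶠ t in 𝓝 s, inner ℝ (γ t - γ s) (normal γ s) = 0) → curvature γ s = 0 := by
    intro h
    have h' : (fun t => inner ℝ (γ t - γ s) (normal γ s)) =ᶠ[𝓝 s] fun _ => (0 : ℝ) := h
    rw [← e2, h'.deriv.deriv_eq]
    simp
  rcases hγ.convex s with h | h
  · rcases lt_or_ge (curvature γ s) 0 with hκ | hκ
    · refine absurd (hflat ?_) hκ.ne
      filter_upwards [isLocalMax_of_deriv_deriv_neg (by rwa [e2]) e3 (hd1 s).continuousAt] with t ht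
      simp only [sub_self, inner_zero_left] at ht
      exact le_antisymm ht (h t)
    · exact mul_nonneg hκ (h t)
  · rcases lt_or_ge 0 (curvature γ s) with hκ | hκ
    · refine absurd (hflat ?_) hκ.ne'
      filter_upwards [isLocalMin_of_deriv_deriv_pos (by rwa [e2]) e3 (hd1 s).continuousAt] with t ht
      simp only [sub_self, inner_zero_left] at ht
      exact le_antisymm (h t) ht
    · exact mul_nonneg_of_nonpos_of_nonpos hκ (h t)

/-- By the preceding inequality `pedal' γ (1, γ t)` is at least `-1`, and it equals `-1` at `s`,
which is thus a minimum. Its derivative there reduces to the tangential component of `γ t - γ s`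
times a nonzero factor, so that component vanishes too. -/
theorem eq_of_inner_normal_eq_zero {γ : ℝ → Plane} {L : ℝ} (hγ : IsClosedConvexCurve γ L)
    (hflat : ∀ s, curvature γ s ≠ 0) {s t : ℝ} (h : inner ℝ (γ t - γ s) (normal γ s) = 0) :
    γ t = γ s := by
  have hmin : IsLocalMin (pedal' γ (1, γ t)) s := by
    refine Eventually.of_forall fun r => ?_
    have := curvature_mul_inner_nonneg hγ r t
    simp only [pedal', one_smul, h]
    linarith
  have h0 := hmin.hasDerivAt_eq_zero (hasDerivAt_pedal' hγ _ s)
  simp only [pedal'', one_smul, h] at h0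
  have : inner ℝ (γ t - γ s) (tangent γ s) = 0 := by
    simpa [hflat s] using h0
  exact sub_eq_zero.1 (eq_zero_of_inner hγ this h)

theorem curvature_mul_pos {γ : ℝ → Plane} {L : ℝ} (hγ : IsClosedConvexCurve γ L)
    (hflat : ∀ s, curvature γ s ≠ 0) (s t : ℝ) : 0 < curvature γ s * curvature γ t := by
  have key : ∀ s t, curvature γ s < 0 → ¬ 0 < curvature γ t := by
    intro s t hs ht
    obtain ⟨r, -, hr⟩ := isPreconnected_univ.intermediate_value (Set.mem_univ s) (Set.mem_univ t)
      (contDiff_curvature hγ).continuous.continuousOn ⟨hs.le, ht.le⟩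
    exact hflat r hr
  rcases (hflat s).lt_or_gt with hs | hs <;> rcases (hflat t).lt_or_gt with ht | ht
  · exact mul_pos_of_neg_of_neg hs ht
  · exact absurd ht (key s t hs)
  · exact absurd hs (key t s ht)
  · exact mul_pos hs ht

/-- With equal normals, and curvatures of equal sign, each of the two points lies weakly on the
inner side of the other's tangent line, so these parallel lines coincide. -/
theorem normal_ne {γ : ℝ → Plane} {L : ℝ} (hγ : IsClosedConvexCurve γ L)
    (hflat : ∀ s, curvature γ s ≠ 0) {a b : ℝ} (hab : a < b) (hba : b < a + L) :
    normal γ a ≠ normal γ b := by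
  intro h
  refine curve_ne hγ hab hba (eq_of_inner_normal_eq_zero hγ hflat (s := a) (t := b) ?_).symm
  have h1 := curvature_mul_inner_nonneg hγ a b
  have h2 := curvature_mul_inner_nonneg hγ b a
  rw [← h, ← neg_sub, inner_neg_left] at h2
  have h3 := curvature_mul_pos hγ hflat a b
  by_contra hne
  have h4 : 0 < curvature γ a * inner ℝ (γ b - γ a) (normal γ a) :=
    h1.lt_of_ne' (mul_ne_zero (hflat a) hne)
  nlinarith [mul_pos h4 (sq_pos_of_ne_zero (hflat b)), mul_nonneg h2 h3.le]

/-- Orthotricentres escaping to infinity, rescaled to unit length, subconverge to a direction `v`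
whose function `pedal γ (0, v)` has three zeros or a double zero on a period. At a zero, `v` is plus
or minus the normal. Three zeros would repeat a normal, and a double zero is excluded by nonzero
curvature. -/
theorem isBounded_orthotricentres {γ : ℝ → Plane} {L : ℝ} (hγ : IsClosedConvexCurve γ L)
    (hflat : ∀ s, curvature γ s ≠ 0) : Bornology.IsBounded (orthotricentres γ) := by
  by_contra hb
  rw [isBounded_iff_forall_norm_le] at hb
  push Not at hb
  choose Q hQ hQn using fun n : ℕ => hb (n + 1)
  have hQpos : ∀ n, 0 < ‖Q n‖ := fun n => lt_trans (by positivity) (hQn n)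
  have hsph : ∀ n, ‖Q n‖⁻¹ • Q n ∈ Metric.sphere (0 : Plane) 1 := fun n => by
    rw [mem_sphere_zero_iff_norm, norm_smul, norm_inv, norm_norm, inv_mul_cancel₀ (hQpos n).ne']
  obtain ⟨v, hv, φ, hφ, hlim⟩ := (isCompact_sphere (0 : Plane) 1).tendsto_subseq hsph
  have hinv : Tendsto (fun n => ‖Q n‖⁻¹) atTop (𝓝 0) := by
    refine tendsto_inv_atTop_zero.comp (tendsto_atTop_mono (fun n => ?_)
      tendsto_natCast_atTop_atTop)
    linarith [hQn n]
  have hcl : ((0 : ℝ), v) ∈ closure {p | HasThreeZeros (pedal γ p) L} := by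
    refine mem_closure_of_tendsto ((hinv.comp hφ.tendsto_atTop).prodMk_nhds hlim)
      (Eventually.of_forall fun n => ?_)
    obtain ⟨a, b, c, h1, h2, h3, ha, hb, hc⟩ := (mem_orthotricentres_iff hγ).1 (hQ (φ n))
    -- `pedal` is homogeneous in its parameter, so rescaling preserves its zeros.
    have hs : ∀ s, pedal γ (‖Q (φ n)‖⁻¹, ‖Q (φ n)‖⁻¹ • Q (φ n)) s =
        ‖Q (φ n)‖⁻¹ * pedal γ (1, Q (φ n)) s := fun s => by
      simp only [pedal, one_smul, ← smul_sub, inner_smul_left]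
      simp
    exact ⟨a, b, c, h1, h2, h3, by simp [hs, ha], by simp [hs, hb], by simp [hs, hc]⟩
  have hv1 : ‖v‖ = 1 := by simpa using hv
  have hn : ∀ s, pedal γ (0, v) s = 0 → v = inner ℝ v (normal γ s) • normal γ s ∧
      inner ℝ v (normal γ s) ^ 2 = 1 := by
    intro s hs
    have h1 := eq_inner_smul_normal hγ (s := s) (v := v) (by simpa [pedal] using hs)
    refine ⟨h1, ?_⟩
    have h2 := real_inner_self_eq_norm_sq v
    rw [hv1] at h2
    nth_rewrite 1 2 [h1] at h2
    rw [inner_smul_left, inner_smul_right, inner_normal_normal hγ] at h2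
    simp only [conj_trivial] at h2
    linarith
  rcases zeros_of_mem_closure hγ.length_pos (continuous_pedal hγ) (continuous_pedal' hγ)
    (continuous_pedal'' hγ) (hasDerivAt_pedal hγ) (hasDerivAt_pedal' hγ) (periodic_pedal hγ)
    hcl with ⟨a, b, c, hab, hbc, hca, ha, hb, hc⟩ | ⟨a, ha, ha', -⟩
  · have hne : ∀ {s t}, s < t → t < s + L → pedal γ (0, v) s = 0 → pedal γ (0, v) t = 0 →
        inner ℝ v (normal γ s) ≠ inner ℝ v (normal γ t) := by
      intro s t hst hts hs ht he
      have h1 := (hn s hs).1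
      rw [he] at h1
      have h2 := h1.symm.trans (hn t ht).1
      have h3 : inner ℝ v (normal γ t) ≠ 0 := fun h0 => by
        have := (hn t ht).2
        rw [h0] at this
        norm_num at this
      exact normal_ne hγ hflat hst hts (smul_right_injective _ h3 h2)
    have h1 := hne hab (by linarith) ha hb
    have h2 := hne hbc (by linarith) hb hc
    have h3 := hne (hab.trans hbc) hca ha hc
    -- Three numbers equal to `1` or `-1` cannot be pairwise distinct.
    rcases sq_eq_one_iff.1 (hn a ha).2 with ea | ea <;>
    rcases sq_eq_one_iff.1 (hn b hb).2 with eb | eb <;>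
    rcases sq_eq_one_iff.1 (hn c hc).2 with ec | ec <;> simp_all
  · have h1 := (hn a ha).2
    have h2 : inner ℝ v (normal γ a) = 0 := by simpa [pedal', hflat a] using ha'
    rw [h2] at h1
    norm_num at h1

theorem exists_isMax_of_periodic {f : ℝ → ℝ} {L : ℝ} (hL : 0 < L) (hf : Continuous f)
    (hp : Function.Periodic f L) : ∃ s, ∀ t, f t ≤ f s := by
  obtain ⟨s, -, hs⟩ := isCompact_Icc.exists_isMaxOn (Set.nonempty_Icc.2 hL.le)
    (hf.continuousOn (s := Set.Icc 0 L))
  refine ⟨s, fun t => ?_⟩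
  obtain ⟨r, hr, ht⟩ := hp.exists_mem_Ico₀ hL t
  rw [ht]
  exact hs ⟨hr.1, hr.2.le⟩

/-- The distance to `Q` is constant, so only surjectivity onto the circle needs an argument. Where
`inner ℝ (Q - γ s) (Q - P)` is maximal, `Q - P` is normal to the curve, so `γ s` is `P` or its
antipode. In the antipodal case the maximum is already the least possible value, so the curve would
be constant. -/
theorem range_eq_sphere_of_pedal_eq_zero {γ : ℝ → Plane} {L : ℝ} (hγ : IsClosedConvexCurve γ L)
    {Q : Plane} (h : ∀ s, pedal γ (1, Q) s = 0) :
    Set.range γ = Metric.sphere Q ‖Q - γ 0‖ := by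
  have hr : ∀ s, inner ℝ (Q - γ s) (Q - γ s) = ‖Q - γ 0‖ ^ 2 := by
    intro s
    have := is_const_of_deriv_eq_zero (fun t => (hasDerivAt_sq_dist hγ Q t).differentiableAt)
      (fun t => (hasDerivAt_sq_dist hγ Q t).deriv.trans (h t)) s 0
    rw [← real_inner_self_eq_norm_sq]
    linarith
  refine Set.Subset.antisymm ?_ fun P hP => ?_
  · rintro _ ⟨s, rfl⟩
    rw [mem_sphere_iff_norm, norm_sub_rev]
    have := hr s
    rw [real_inner_self_eq_norm_sq] at this
    exact (sq_eq_sq₀ (norm_nonneg _) (norm_nonneg _)).1 this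
  · rw [mem_sphere_iff_norm, norm_sub_rev] at hP
    have hP2 : inner ℝ (Q - P) (Q - P) = ‖Q - γ 0‖ ^ 2 := by
      rw [real_inner_self_eq_norm_sq, hP]
    have hd : ∀ s, HasDerivAt (fun s => inner ℝ (Q - γ s) (Q - P))
        (-inner ℝ (tangent γ s) (Q - P)) s := fun s =>
      (((hasDerivAt_curve hγ s).const_sub Q).inner ℝ (hasDerivAt_const s (Q - P))).congr_deriv
        (by simp)
    obtain ⟨s, hs⟩ := exists_isMax_of_periodic hγ.length_pos
      (continuous_iff_continuousAt.2 fun s => (hd s).continuousAt)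
      (fun s => by simp only [hγ.periodic s])
    have hs0 := (show IsLocalMax _ s from Eventually.of_forall hs).hasDerivAt_eq_zero (hd s)
    rw [neg_eq_zero, real_inner_comm] at hs0
    have h1 := eq_inner_smul_normal hγ hs0
    have h2 := eq_inner_smul_normal hγ ((pedal_one γ Q s).symm.trans (h s))
    have hsq : inner ℝ (Q - γ s) (normal γ s) ^ 2 = inner ℝ (Q - P) (normal γ s) ^ 2 := by
      have h3 := hr s
      rw [← hP2, h1, h2, inner_smul_left, inner_smul_left, inner_smul_right, inner_smul_right,
        inner_normal_normal hγ] at h3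
      simp only [conj_trivial] at h3
      linarith
    rcases sq_eq_sq_iff_eq_or_eq_neg.1 hsq with he | he
    · rw [he, ← h1] at h2
      exact ⟨s, by simpa using h2⟩
    · rw [he, neg_smul, ← h1] at h2
      have hconst : ∀ t, γ t = Q + (Q - P) := by
        intro t
        have h3 := hs t
        rw [h2, inner_neg_left, hP2] at h3
        have h4 : inner ℝ ((Q - γ t) + (Q - P)) ((Q - γ t) + (Q - P)) ≤ 0 := by
          rw [inner_add_left, inner_add_right, inner_add_right, hr, hP2,
            real_inner_comm (Q - γ t) (Q - P)]
          linarith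
        have h5 := real_inner_self_nonpos.1 h4
        rw [← sub_eq_zero, ← neg_eq_zero, ← h5]
        abel
      have hc : HasDerivAt γ 0 0 := by
        rw [show γ = fun _ => Q + (Q - P) from funext hconst]
        exact hasDerivAt_const _ _
      have := hγ.unit_speed 0
      rw [(hasDerivAt_curve hγ 0).unique hc, norm_zero] at this
      exact absurd this zero_ne_one

/-! ### The caustic -/

theorem eq_curvatureCentre_iff {γ : ℝ → Plane} {L : ℝ} (hγ : IsClosedConvexCurve γ L)
    (hflat : ∀ s, curvature γ s ≠ 0) {Q : Plane} {s : ℝ} :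
    Q = curvatureCentre γ s ↔ pedal γ (1, Q) s = 0 ∧ pedal' γ (1, Q) s = 0 := by
  constructor
  · rintro rfl
    rw [pedal_one, pedal', curvatureCentre]
    simp only [one_smul, add_sub_cancel_left, inner_smul_left, inner_normal_normal hγ,
      real_inner_comm (tangent γ s) (normal γ s), inner_tangent_normal]
    simp [hflat s]
  · rintro ⟨h1, h2⟩
    rw [pedal_one] at h1
    have h3 : inner ℝ (Q - γ s) (normal γ s) = (curvature γ s)⁻¹ := by
      rw [pedal'] at h2
      simp only [one_smul] at h2
      exact eq_inv_of_mul_eq_one_right (by linarith)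
    rw [curvatureCentre, ← h3, ← eq_inner_smul_normal hγ h1]
    abel

theorem vertexCentres_subset_caustic (γ : ℝ → Plane) : vertexCentres γ ⊆ caustic γ := by
  rintro _ ⟨s, -, rfl⟩
  exact ⟨s, rfl⟩

theorem dense_compl_caustic {γ : ℝ → Plane} {L : ℝ} (hγ : IsClosedConvexCurve γ L)
    (hflat : ∀ s, curvature γ s ≠ 0) : Dense (caustic γ)ᶜ := by
  refine ContDiff.dense_compl_range_of_finrank_lt_finrank (ContDiff.of_le (n := ∞) ?_ ?_) ?_
  · exact hγ.smooth.add (((contDiff_curvature hγ).inv hflat).smul (contDiff_normal hγ))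
  · exact_mod_cast le_top
  · simp

/-! ### Alternating centres and the caustic -/

/-- The points whose distance function to the curve has a derivative alternating in sign. -/
def alternatingCentres (γ : ℝ → Plane) (L : ℝ) : Set Plane :=
  {Q | Alternates (pedal γ (1, Q)) L}

theorem continuous_pedal_one (γ : ℝ → Plane) (s : ℝ) :
    Continuous fun Q => pedal γ (1, Q) s := by
  unfold pedal
  fun_prop

theorem isOpen_alternatingCentres (γ : ℝ → Plane) (L : ℝ) :
    IsOpen (alternatingCentres γ L) := by
  rw [isOpen_iff_mem_nhds]
  rintro Q ⟨x, y, z, w, h1, h2, h3, h4, hx, hy, hz, hw⟩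
  filter_upwards [(continuous_pedal_one γ x).continuousAt.eventually_lt_const hx,
    (continuous_pedal_one γ y).continuousAt.eventually_const_lt hy,
    (continuous_pedal_one γ z).continuousAt.eventually_lt_const hz,
    (continuous_pedal_one γ w).continuousAt.eventually_const_lt hw] with R hx hy hz hw
  exact ⟨x, y, z, w, h1, h2, h3, h4, hx, hy, hz, hw⟩

theorem alternatingCentres_subset {γ : ℝ → Plane} {L : ℝ} (hγ : IsClosedConvexCurve γ L) :
    alternatingCentres γ L ⊆ orthotricentres γ := fun _ hQ =>
  mem_orthotricentres_iff_card.2 (le_trans (by norm_num) (four_le_numNormals hγ hQ))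

theorem orthotricentres_diff_caustic_subset {γ : ℝ → Plane} {L : ℝ}
    (hγ : IsClosedConvexCurve γ L) (hflat : ∀ s, curvature γ s ≠ 0) :
    orthotricentres γ \ caustic γ ⊆ alternatingCentres γ L := by
  rintro Q ⟨hQ, hQc⟩
  obtain ⟨a, b, c, hab, hbc, hca, ha, hb, hc⟩ := (mem_orthotricentres_iff hγ).1 hQ
  have hne : ∀ s, pedal γ (1, Q) s = 0 → pedal' γ (1, Q) s ≠ 0 := fun s hs hs' =>
    hQc ⟨s, ((eq_curvatureCentre_iff hγ hflat).2 ⟨hs, hs'⟩).symm⟩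
  exact alternates_of_simple_zeros (periodic_pedal hγ _) (hasDerivAt_pedal hγ _) hab hbc hca
    ha hb hc (hne a ha) (hne b hb) (hne c hc)

/-- Moving `Q` along the normal at `a` keeps the zero at `a` but makes it simple, with a direction
of crossing that can be chosen. As the curve is not a circle, the function also takes both signs
elsewhere, and these survive small moves; the right direction yields four alternations. -/
theorem caustic_subset_closure {γ : ℝ → Plane} {L : ℝ} (hγ : IsClosedConvexCurve γ L)
    (hflat : ∀ s, curvature γ s ≠ 0)
    (hcircle : ∀ (c : Plane) (r : ℝ), Set.range γ ≠ Metric.sphere c r) :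
    caustic γ ⊆ closure (alternatingCentres γ L) := by
  rintro Q ⟨a, haQ⟩
  obtain ⟨ha, ha'⟩ := (eq_curvatureCentre_iff hγ hflat).1 haQ.symm
  have hne : ∃ s, pedal γ (1, Q) s ≠ 0 := by
    by_contra! h
    exact hcircle _ _ (range_eq_sphere_of_pedal_eq_zero hγ h)
  have hL := hγ.length_pos
  have hp := periodic_pedal hγ (1, Q)
  obtain ⟨x', hx'⟩ := exists_neg_of_periodic hL (periodic_sq_dist hγ Q) (hasDerivAt_sq_dist hγ Q) hne
  obtain ⟨y', hy'⟩ := exists_pos_of_periodic hL (periodic_sq_dist hγ Q) (hasDerivAt_sq_dist hγ Q) hne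
  obtain ⟨x, hxI, hx⟩ := hp.exists_mem_Ico hL x' a
  obtain ⟨y, hyI, hy⟩ := hp.exists_mem_Ico hL y' a
  rw [hx] at hx'
  rw [hy] at hy'
  have hax : a < x := hxI.1.lt_of_ne (by rintro rfl; linarith)
  have hay : a < y := hyI.1.lt_of_ne (by rintro rfl; linarith)
  have hκ := hflat a
  have hpert : ∀ (c : ℝ), pedal γ (1, Q + c • normal γ a) a = 0 ∧
      pedal' γ (1, Q + c • normal γ a) a = c * curvature γ a := by
    intro c
    have e : Q + c • normal γ a - γ a = (Q - γ a) + c • normal γ a := by abel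
    simp only [pedal, pedal', one_smul] at ha ha' ⊢
    rw [e, inner_add_left, inner_add_left, inner_smul_left, inner_smul_left,
      inner_normal_normal hγ, real_inner_comm (tangent γ a) (normal γ a), inner_tangent_normal, ha]
    refine ⟨by simp, ?_⟩
    simp only [conj_trivial]
    linear_combination ha'
  have main : ∀ σ : ℝ, (∀ ε > 0, pedal γ (1, Q + (ε * σ) • normal γ a) x < 0 →
      0 < pedal γ (1, Q + (ε * σ) • normal γ a) y →
      Q + (ε * σ) • normal γ a ∈ alternatingCentres γ L) →
      Q ∈ closure (alternatingCentres γ L) := by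
    intro σ hσ
    have hc : Continuous fun ε : ℝ => Q + (ε * σ) • normal γ a := by fun_prop
    have h0 : Q + ((0 : ℝ) * σ) • normal γ a = Q := by simp
    have hlim : Tendsto (fun ε : ℝ => Q + (ε * σ) • normal γ a) (𝓝[>] 0) (𝓝 Q) := by
      have := hc.tendsto 0
      rw [h0] at this
      exact this.mono_left nhdsWithin_le_nhds
    refine mem_closure_of_tendsto hlim ?_
    filter_upwards [self_mem_nhdsWithin,
      hlim.eventually ((continuous_pedal_one γ x).continuousAt.eventually_lt_const hx'),
      hlim.eventually ((continuous_pedal_one γ y).continuousAt.eventually_const_lt hy')]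
      with ε hε h1 h2
    exact hσ ε hε h1 h2
  obtain ⟨δ, hδ, h1, h2, h3, h4⟩ : ∃ δ, 0 < δ ∧ a + δ < x ∧ x < a + L - δ ∧ a + δ < y ∧
      y < a + L - δ := by
    have h1 : 0 < x - a := by linarith
    have h2 : 0 < a + L - x := by linarith [hxI.2]
    have h3 : 0 < y - a := by linarith
    have h4 : 0 < a + L - y := by linarith [hyI.2]
    obtain ⟨δ, hδ0, hδ⟩ := exists_between (lt_min (lt_min h1 h2) (lt_min h3 h4))
    simp only [lt_min_iff] at hδ
    exact ⟨δ, hδ0, by linarith [hδ.1.1], by linarith [hδ.1.2], by linarith [hδ.2.1],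
      by linarith [hδ.2.2]⟩
  -- The negative value at `x` and the positive one at `y` need an upward crossing at `a` if `x`
  -- comes first, and a downward one otherwise.
  rcases lt_trichotomy x y with hxy | hxy | hxy
  · refine main (curvature γ a) fun ε hε hεx hεy => ?_
    obtain ⟨e1, e2⟩ := hpert (ε * curvature γ a)
    have hpos : 0 < ε * curvature γ a * curvature γ a := by
      rw [mul_assoc]; exact mul_pos hε (mul_self_pos.2 hκ)
    obtain ⟨u, v, u1, u2, v1, v2, hu, hv⟩ := exists_sign_change (hasDerivAt_pedal hγ _ a) e1
      (by rwa [e2]) hδ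
    exact ⟨u, v, x, y, by linarith, by linarith, hxy, by linarith, hu, hv, hεx, hεy⟩
  · rw [hxy] at hx'
    linarith
  · refine main (-curvature γ a) fun ε hε hεx hεy => ?_
    obtain ⟨e1, e2⟩ := hpert (ε * -curvature γ a)
    have hneg : ε * -curvature γ a * curvature γ a < 0 := by
      have := mul_pos hε (mul_self_pos.2 hκ)
      linarith
    obtain ⟨u, v, u1, u2, v1, v2, hu, hv⟩ := exists_sign_change_of_neg (hasDerivAt_pedal hγ _ a) e1
      (by rwa [e2]) hδ
    refine ⟨v, y, x, u + L, by linarith, hxy, by linarith, by linarith, hv, hεy, hεx, ?_⟩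
    rwa [periodic_pedal hγ]

/-! ### Closure of the orthotricentres and the core -/

theorem closure_orthotricentres_subset {γ : ℝ → Plane} {L : ℝ} (hγ : IsClosedConvexCurve γ L)
    (hflat : ∀ s, curvature γ s ≠ 0) :
    closure (orthotricentres γ) ⊆ orthotricentres γ ∪ vertexCentres γ := by
  intro Q hQ
  have hcl : ((1 : ℝ), Q) ∈ closure {p | HasThreeZeros (pedal γ p) L} :=
    map_mem_closure (by fun_prop : Continuous fun Q : Plane => ((1 : ℝ), Q)) hQ
      fun R hR => (mem_orthotricentres_iff hγ).1 hR
  rcases zeros_of_mem_closure hγ.length_pos (continuous_pedal hγ) (continuous_pedal' hγ)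
    (continuous_pedal'' hγ) (hasDerivAt_pedal hγ) (hasDerivAt_pedal' hγ) (periodic_pedal hγ)
    hcl with h | ⟨a, ha, ha', h⟩
  · exact Or.inl ((mem_orthotricentres_iff hγ).2 h)
  by_cases h2 : pedal'' γ (1, Q) a = 0
  · refine Or.inr ⟨a, ?_, (eq_curvatureCentre_iff hγ hflat).2 ⟨ha, ha'⟩⟩
    simp only [pedal, pedal', pedal''] at ha ha' h2
    rw [ha, mul_zero, sub_zero, mul_eq_zero] at h2
    -- If the normal component vanished, `pedal'` would be `-1` instead of `0`.
    refine h2.resolve_right fun h0 => ?_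
    rw [h0] at ha'
    norm_num at ha'
  · obtain ⟨c, hac, hca, hc⟩ := h.resolve_right h2
    obtain ⟨d, ⟨had, hda⟩, hdc, hd⟩ := exists_third_zero (periodic_sq_dist hγ Q)
      (hasDerivAt_sq_dist hγ Q) (periodic_pedal hγ _) (hasDerivAt_pedal hγ _)
      (hasDerivAt_pedal' hγ _) ha ha' h2 hac hca hc
    refine Or.inl ((mem_orthotricentres_iff hγ).2 ?_)
    rcases hdc.lt_or_gt with h | h
    · exact ⟨a, d, c, had, h, hca, ha, hd, hc⟩
    · exact ⟨a, c, d, hac, h, hda, ha, hc, hd⟩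

theorem closure_alternatingCentres {γ : ℝ → Plane} {L : ℝ} (hγ : IsClosedConvexCurve γ L)
    (hflat : ∀ s, curvature γ s ≠ 0)
    (hcircle : ∀ (c : Plane) (r : ℝ), Set.range γ ≠ Metric.sphere c r) :
    closure (alternatingCentres γ L) = closure (orthotricentres γ) := by
  refine Set.Subset.antisymm (closure_mono (alternatingCentres_subset hγ))
    (closure_minimal (fun Q hQ => ?_) isClosed_closure)
  by_cases hc : Q ∈ caustic γ
  · exact caustic_subset_closure hγ hflat hcircle hc
  · exact subset_closure (orthotricentres_diff_caustic_subset hγ hflat ⟨hQ, hc⟩)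

/-- Off the caustic the alternating set is closed as well as open: a limit of alternating points
there is no vertex centre, hence is an orthotricentre and so alternating. A connected domain that
meets the set lies inside it. -/
theorem domain_subset_alternatingCentres {γ : ℝ → Plane} {L : ℝ} (hγ : IsClosedConvexCurve γ L)
    (hflat : ∀ s, curvature γ s ≠ 0) {Q : Plane} (hQ : Q ∈ orthotricentres γ)
    (hQc : Q ∉ caustic γ) :
    connectedComponentIn (caustic γ)ᶜ Q ⊆ alternatingCentres γ L := by
  refine isPreconnected_connectedComponentIn.subset_of_closure_inter_subset
    (isOpen_alternatingCentres γ L) ⟨Q, mem_connectedComponentIn hQc,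
      orthotricentres_diff_caustic_subset hγ hflat ⟨hQ, hQc⟩⟩ ?_
  rintro R ⟨hR, hRU⟩
  have hRc : R ∉ caustic γ := connectedComponentIn_subset _ _ hRU
  refine orthotricentres_diff_caustic_subset hγ hflat ⟨?_, hRc⟩
  exact (closure_orthotricentres_subset hγ hflat
    (closure_mono (alternatingCentres_subset hγ) hR)).resolve_right
    fun h => hRc (vertexCentres_subset_caustic γ h)

theorem biUnion_coreDomains {γ : ℝ → Plane} {L : ℝ} (hγ : IsClosedConvexCurve γ L)
    (hflat : ∀ s, curvature γ s ≠ 0) :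
    ⋃ U ∈ coreDomains γ, U = alternatingCentres γ L ∩ (caustic γ)ᶜ := by
  refine Set.Subset.antisymm (Set.iUnion₂_subset ?_) ?_
  · rintro U ⟨⟨Q, hQ, rfl⟩, hU⟩ R hR
    have hRc := connectedComponentIn_subset _ _ hR
    exact ⟨orthotricentres_diff_caustic_subset hγ hflat
      ⟨mem_orthotricentres_iff_card.2 (le_trans (by norm_num) (hU R hR)), hRc⟩, hRc⟩
  · rintro Q ⟨hQ, hQc⟩
    exact Set.mem_biUnion (x := connectedComponentIn (caustic γ)ᶜ Q) ⟨⟨Q, hQc, rfl⟩, fun R hR =>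
      four_le_numNormals hγ (domain_subset_alternatingCentres hγ hflat
        (alternatingCentres_subset hγ hQ) hQc hR)⟩ (mem_connectedComponentIn hQc)

/-- Since the alternating set is open and the complement of the caustic is dense, removing the
caustic does not change its closure. -/
theorem core_eq_closure {γ : ℝ → Plane} {L : ℝ} (hγ : IsClosedConvexCurve γ L)
    (hflat : ∀ s, curvature γ s ≠ 0)
    (hcircle : ∀ (c : Plane) (r : ℝ), Set.range γ ≠ Metric.sphere c r) :
    core γ = closure (orthotricentres γ) := by
  rw [core, biUnion_coreDomains hγ hflat, ← closure_alternatingCentres hγ hflat hcircle]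
  exact (closure_mono Set.inter_subset_left).antisymm (closure_minimal
    ((dense_compl_caustic hγ hflat).open_subset_closure_inter (isOpen_alternatingCentres γ L))
    isClosed_closure)

theorem core_subset_interiorRegion {γ : ℝ → Plane} {L : ℝ} (hγ : IsClosedConvexCurve γ L)
    (hflat : ∀ s, curvature γ s ≠ 0) : core γ ⊆ interiorRegion γ := by
  refine closure_mono (Set.biUnion_subset_biUnion_left fun U hU => ⟨hU.1, ?_⟩)
  exact (isBounded_orthotricentres hγ hflat).subset fun Q hQ =>
    mem_orthotricentres_iff_card.2 (le_trans (by norm_num) (hU.2 Q hQ))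

end ConvexCaustic

end

theorem mainTheorem3 (γ : ℝ → ConvexCaustic.Plane) (L : ℝ)
    (hγ : ConvexCaustic.IsClosedConvexCurve γ L)
    (hflat : ∀ s, ConvexCaustic.curvature γ s ≠ 0)
    (hcircle : ∀ (c : ConvexCaustic.Plane) (r : ℝ), Set.range γ ≠ Metric.sphere c r) :
    IsCompact (closure (ConvexCaustic.orthotricentres γ)) ∧
      closure (ConvexCaustic.orthotricentres γ) ⊆ ConvexCaustic.interiorRegion γ ∧
      closure (ConvexCaustic.orthotricentres γ) = ConvexCaustic.core γ ∧
      closure (ConvexCaustic.orthotricentres γ) =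
        ConvexCaustic.orthotricentres γ ∪ ConvexCaustic.vertexCentres γ := by
  have hcore := ConvexCaustic.core_eq_closure hγ hflat hcircle
  refine ⟨(ConvexCaustic.isBounded_orthotricentres hγ hflat).isCompact_closure, ?_, hcore.symm,
    (ConvexCaustic.closure_orthotricentres_subset hγ hflat).antisymm
      (Set.union_subset subset_closure ?_)⟩
  · rw [← hcore]
    exact ConvexCaustic.core_subset_interiorRegion hγ hflat
  · rw [← ConvexCaustic.closure_alternatingCentres hγ hflat hcircle]
    exact (ConvexCaustic.vertexCentres_subset_caustic γ).trans
      (ConvexCaustic.caustic_subset_closure hγ hflat hcircle)
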